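/- For integers $l,m,n\ge 0$, let $T_{l,m,n}$ be the starlike tree obtained from the disjoint union of three paths $P_l$, $P_m$, $P_n$ (on $l$, $m$, $n$ vertices respectively) by adding one new vertex and joining it by an edge to one end point of each (nonempty) path. For a finite graph $G$, let $\rho(G)$ denote its spectral radius, that is, the largest eigenvalue of its adjacency matrix. Then $$\lim_{n\to\infty}\rho(T_{1,n,n})=\sqrt{2+\sqrt5}.$$ -/

import Mathlib

/-- The end point of each of three (possibly empty) paths that gets joined to the centre:
the vertex number `0` of each path. -/
def IsInnerEnd {l m n : ℕ} : Fin l ⊕ (Fin m ⊕ Fin n) → Prop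
  | .inl i => i.val = 0
  | .inr (.inl i) => i.val = 0
  | .inr (.inr i) => i.val = 0

/-- The starlike tree `T_{l,m,n}`: the disjoint union of the paths `P_l`, `P_m`, `P_n`
(on `l`, `m`, `n` vertices) together with one further vertex `none`, the centre, which is
joined by an edge to one end point of each path. -/
def starlikeTree (l m n : ℕ) : SimpleGraph (Option (Fin l ⊕ (Fin m ⊕ Fin n))) where
  Adj
    | none, none => False
    | none, some v => IsInnerEnd v
    | some u, none => IsInnerEnd u
    | some u, some v =>
        (SimpleGraph.pathGraph l ⊕g (SimpleGraph.pathGraph m ⊕g SimpleGraph.pathGraph n)).Adj u v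
  symm := ⟨by
    rintro (_ | u) (_ | v) h
    · exact h
    · exact h
    · exact h
    · exact SimpleGraph.Adj.symm h⟩
  loopless := ⟨by
    rintro (_ | u) h
    · exact h
    · exact SimpleGraph.irrefl _ h⟩

open Classical in
/-- The real eigenvalues of the adjacency matrix of a finite graph. -/
def adjEigenvalues {V : Type*} [Fintype V] (G : SimpleGraph V) : Set ℝ :=
  {μ | Module.End.HasEigenvalue (Matrix.toLin' (G.adjMatrix ℝ)) μ}

/-- The spectral radius (index) of a finite graph: the largest eigenvalue of its adjacency
matrix. -/
noncomputable def graphSpectralRadius {V : Type*} [Fintype V] (G : SimpleGraph V) : ℝ :=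
  sSup (adjEigenvalues G)

/-- On a nonempty finite graph the supremum defining the spectral radius is attained, so it
really is the largest eigenvalue. -/
theorem isGreatest_graphSpectralRadius {V : Type*} [Fintype V] [Nonempty V]
    (G : SimpleGraph V) : IsGreatest (adjEigenvalues G) (graphSpectralRadius G) := by
  classical
  have hfin : (adjEigenvalues G).Finite := by
    unfold adjEigenvalues
    exact Module.End.finite_hasEigenvalue _
  have hne : (adjEigenvalues G).Nonempty := by
    have hA : (G.adjMatrix ℝ).IsHermitian := by
      rw [Matrix.IsHermitian, Matrix.conjTranspose_eq_transpose_of_trivial]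
      exact G.isSymm_adjMatrix
    obtain ⟨i⟩ := ‹Nonempty V›
    refine ⟨hA.eigenvalues i, ?_⟩
    have h := hA.eigenvalues_mem_spectrum_real i
    rw [← Matrix.spectrum_toLin'] at h
    have h2 := Module.End.hasEigenvalue_iff_mem_spectrum.mpr h
    unfold adjEigenvalues
    simp only [Set.mem_ofPred_eq]
    convert h2
  exact ⟨hne.csSup_mem hfin, fun x hx => le_csSup hfin.bddAbove hx⟩

/-!
The limit is the spectral radius of the infinite tree `T_{1,∞,∞}`, whose positive eigenvector is
explicit. With `λ = t + t⁻¹`, give the centre the weight `1`, the pendant vertex the weight `λ⁻¹`,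
and the vertex at distance `d` along a long leg the weight `t ^ d`. The eigenvalue equation then
holds at every vertex except perhaps the centre, where it reads `λ = 2 * t + λ⁻¹`. This forces
`t⁻² - t² = 1`, so `t² = (√5 - 1) / 2` and `λ² = 2 + √5`.

Restricted to the finite tree `T_{1,n,n}`, this weight satisfies the eigenvalue equation except at
the outer ends of the two long legs, where a neighbour of weight `t ^ (n + 1)` is missing
(`adjMatrix_mulVec_truncatedWeight`). Hence the weight is positive and a subeigenvector for `λ`,
which bounds the spectral radius above by `λ` (`graphSpectralRadius_le_of_mulVec_le`). Used as a
test vector in the Rayleigh quotient (`le_graphSpectralRadius_mul`), the same weight bounds the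
spectral radius below by `λ - 2 * t ^ (2 * n + 1)`. Since `t < 1`, the two bounds squeeze.
-/

open Matrix Finset

/-! ### Bounds on the spectral radius of a graph -/

theorem mem_adjEigenvalues_iff {V : Type*} [Fintype V] (G : SimpleGraph V)
    [DecidableRel G.Adj] {μ : ℝ} :
    μ ∈ adjEigenvalues G ↔ ∃ v : V → ℝ, v ≠ 0 ∧ G.adjMatrix ℝ *ᵥ v = μ • v := by
  classical
  have h : μ ∈ adjEigenvalues G ↔
      Module.End.HasEigenvalue (Matrix.toLin' (G.adjMatrix ℝ)) μ := by
    unfold adjEigenvalues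
    simp only [Set.mem_ofPred_eq]
    convert Iff.rfl
  rw [h]
  constructor
  · intro h
    obtain ⟨v, hv⟩ := h.exists_hasEigenvector
    exact ⟨v, hv.2, by simpa using hv.apply_eq_smul⟩
  · rintro ⟨v, hv, hA⟩
    refine Module.End.hasEigenvalue_of_hasEigenvector (x := v)
      ⟨Module.End.mem_eigenspace_iff.mpr ?_, hv⟩
    simpa using hA

/-- Pairing the entrywise absolute value of an eigenvector with a positive subeigenvector `y`
for `c` shows that no eigenvalue exceeds `c`. -/
theorem graphSpectralRadius_le_of_mulVec_le {V : Type*} [Fintype V] [Nonempty V]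
    (G : SimpleGraph V) [DecidableRel G.Adj] {y : V → ℝ} {c : ℝ} (hy : ∀ i, 0 < y i)
    (h : ∀ i, (G.adjMatrix ℝ *ᵥ y) i ≤ c * y i) : graphSpectralRadius G ≤ c := by
  obtain ⟨v, hv, hA⟩ := (mem_adjEigenvalues_iff G).mp (isGreatest_graphSpectralRadius G).1
  set ρ := graphSpectralRadius G
  set w : V → ℝ := fun i => |v i|
  have hw : ∀ i, ρ * w i ≤ (G.adjMatrix ℝ *ᵥ w) i := by
    intro i
    calc ρ * |v i| ≤ |ρ * v i| := by
          rw [abs_mul]; exact mul_le_mul_of_nonneg_right (le_abs_self _) (abs_nonneg _)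
      _ = |(G.adjMatrix ℝ *ᵥ v) i| := by rw [hA]; rfl
      _ ≤ (G.adjMatrix ℝ *ᵥ w) i := by
          rw [SimpleGraph.adjMatrix_mulVec_apply, SimpleGraph.adjMatrix_mulVec_apply]
          exact abs_sum_le_sum_abs _ _
  have hpos : 0 < y ⬝ᵥ w := by
    obtain ⟨i, hi⟩ := Function.ne_iff.mp hv
    exact sum_pos' (fun j _ => mul_nonneg (hy j).le (abs_nonneg _))
      ⟨i, mem_univ i, mul_pos (hy i) (abs_pos.mpr hi)⟩
  refine le_of_mul_le_mul_right ?_ hpos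
  calc ρ * (y ⬝ᵥ w) = y ⬝ᵥ (ρ • w) := by rw [dotProduct_smul, smul_eq_mul]
    _ ≤ y ⬝ᵥ (G.adjMatrix ℝ *ᵥ w) :=
        sum_le_sum fun i _ => mul_le_mul_of_nonneg_left (hw i) (hy i).le
    _ = (G.adjMatrix ℝ *ᵥ y) ⬝ᵥ w := by
        rw [dotProduct_mulVec, ← mulVec_transpose, SimpleGraph.transpose_adjMatrix]
    _ ≤ (c • y) ⬝ᵥ w :=
        sum_le_sum fun i _ => mul_le_mul_of_nonneg_right (h i) (abs_nonneg _)
    _ = c * (y ⬝ᵥ w) := by rw [smul_dotProduct, smul_eq_mul]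

/-- The Rayleigh bound: `ρ(G) • 1 - A` is positive semidefinite. -/
theorem le_graphSpectralRadius_mul {V : Type*} [Fintype V] (G : SimpleGraph V)
    [DecidableRel G.Adj] [Nonempty V] (x : V → ℝ) :
    x ⬝ᵥ (G.adjMatrix ℝ *ᵥ x) ≤ graphSpectralRadius G * (x ⬝ᵥ x) := by
  classical
  set ρ := graphSpectralRadius G
  have hB : (ρ • (1 : Matrix V V ℝ) - G.adjMatrix ℝ).IsHermitian := by
    rw [IsHermitian, conjTranspose_eq_transpose_of_trivial]
    simp
  have hpsd : (ρ • (1 : Matrix V V ℝ) - G.adjMatrix ℝ).PosSemidef := by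
    rw [hB.posSemidef_iff_eigenvalues_nonneg]
    intro i
    set u : V → ℝ := ⇑(hB.eigenvectorBasis i)
    have hu : u ≠ 0 := by
      intro h0
      apply hB.eigenvectorBasis.orthonormal.ne_zero i
      ext j
      exact congrFun h0 j
    have h := hB.mulVec_eigenvectorBasis i
    have hmem : ρ - hB.eigenvalues i ∈ adjEigenvalues G := by
      refine (mem_adjEigenvalues_iff G).mpr ⟨u, hu, ?_⟩
      rw [sub_mulVec, smul_mulVec, one_mulVec] at h
      rw [sub_smul, ← h, sub_sub_cancel]
    have := (isGreatest_graphSpectralRadius G).2 hmem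
    simp only [Pi.zero_apply]
    linarith
  have h := hpsd.dotProduct_mulVec_nonneg x
  rw [star_trivial, sub_mulVec, smul_mulVec, one_mulVec, dotProduct_sub, dotProduct_smul,
    smul_eq_mul] at h
  linarith

/-! ### The truncated eigenvector of the infinite tree -/

/-- The positive eigenvector of the infinite tree `T_{1,∞,∞}` for the eigenvalue `t + t⁻¹`,
restricted to `T_{1,n,n}`. The vertex number `i` of a long leg is at distance `i + 1` from
the centre. -/
noncomputable def truncatedWeight (t : ℝ) (n : ℕ) : Option (Fin 1 ⊕ (Fin n ⊕ Fin n)) → ℝ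
  | none => 1
  | some (.inl _) => (t + t⁻¹)⁻¹
  | some (.inr (.inl i)) => t ^ (i.val + 1)
  | some (.inr (.inr i)) => t ^ (i.val + 1)

/-- The indicator function of the outer ends of the two long legs of `T_{1,n,n}`. -/
def outerEndIndicator (n : ℕ) : Option (Fin 1 ⊕ (Fin n ⊕ Fin n)) → ℝ
  | none => 0
  | some (.inl _) => 0
  | some (.inr (.inl i)) => if i.val + 1 = n then 1 else 0
  | some (.inr (.inr i)) => if i.val + 1 = n then 1 else 0

theorem truncatedWeight_pos {t : ℝ} (ht : 0 < t) (n : ℕ)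
    (v : Option (Fin 1 ⊕ (Fin n ⊕ Fin n))) : 0 < truncatedWeight t n v := by
  rcases v with _ | _ | i | i <;> simp only [truncatedWeight] <;> positivity

theorem outerEndIndicator_nonneg (n : ℕ) (v : Option (Fin 1 ⊕ (Fin n ⊕ Fin n))) :
    0 ≤ outerEndIndicator n v := by
  rcases v with _ | _ | i | i <;> simp only [outerEndIndicator] <;> first | rfl | split_ifs <;> simp

theorem sum_ite_val_eq {n : ℕ} (f : ℕ → ℝ) (k : ℕ) :
    ∑ j : Fin n, (if j.val = k then f j else 0) = if k < n then f k else 0 := by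
  rw [Fin.sum_univ_eq_sum_range (fun j => if j = k then f j else 0), sum_ite_eq']
  simp

/-- The eigenvalue equation along a leg: the first summand is the contribution of the centre,
which continues the geometric weights by `t ^ 0`. -/
theorem leg_sum {t : ℝ} (ht : t ≠ 0) {n : ℕ} (i : Fin n) :
    (if i.val = 0 then (1 : ℝ) else 0) +
      ∑ j : Fin n, (if i.val + 1 = j.val ∨ j.val + 1 = i.val then t ^ (j.val + 1) else 0) =
    (t + t⁻¹) * t ^ (i.val + 1) - t ^ (n + 1) * if i.val + 1 = n then 1 else 0 := by
  have hsplit : ∀ j : Fin n,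
      (if i.val + 1 = j.val ∨ j.val + 1 = i.val then t ^ (j.val + 1) else 0) =
      (if j.val = i.val + 1 then t ^ (j.val + 1) else 0) +
        (if i.val = 0 then 0 else if j.val = i.val - 1 then t ^ (j.val + 1) else 0) := by
    intro j
    split_ifs <;> first | omega | simp
  have hmul : (t + t⁻¹) * t ^ (i.val + 1) = t ^ (i.val + 2) + t ^ i.val := by
    field_simp
    ring
  have hup := sum_ite_val_eq (n := n) (fun j => t ^ (j + 1)) (i.val + 1)
  have hdown := sum_ite_val_eq (n := n) (fun j => t ^ (j + 1)) (i.val - 1)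
  have hi := i.isLt
  rw [sum_congr rfl fun j _ => hsplit j, sum_add_distrib, hup, hmul]
  by_cases h0 : i.val = 0
  · by_cases hn : i.val + 1 = n
    · simp [h0, ← hn]
    · have : i.val + 1 < n := by omega
      simp only [h0, zero_add] at hn this ⊢
      simp [hn, this, add_comm]
  · have e : i.val - 1 + 1 = i.val := by omega
    simp only [h0, if_false, hdown, e, if_pos (show i.val - 1 < n by omega)]
    by_cases hn : i.val + 1 = n
    · simp [← hn]
    · have : i.val + 1 < n := by omega
      simp [hn, this]

/-- The eigenvalue equation holds except at the outer ends, each of which lacks a neighbour of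
weight `t ^ (n + 1)`. The hypothesis `hc` is the equation at the centre. -/
theorem adjMatrix_mulVec_truncatedWeight {t : ℝ} (ht : 0 < t)
    (hc : (t + t⁻¹)⁻¹ + 2 * t = t + t⁻¹) {n : ℕ} (hn : 0 < n)
    [DecidableRel (starlikeTree 1 n n).Adj] (v : Option (Fin 1 ⊕ (Fin n ⊕ Fin n))) :
    ((starlikeTree 1 n n).adjMatrix ℝ *ᵥ truncatedWeight t n) v =
      (t + t⁻¹) * truncatedWeight t n v - t ^ (n + 1) * outerEndIndicator n v := by
  have hfirst := sum_ite_val_eq (n := n) (fun j => t ^ (j + 1)) 0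
  have hl : t + t⁻¹ ≠ 0 := by positivity
  have h1 : ∀ u, (starlikeTree 1 n n).Adj none (some u) ↔ IsInnerEnd u := fun _ => Iff.rfl
  have h2 : ∀ u, (starlikeTree 1 n n).Adj (some u) none ↔ IsInnerEnd u := fun _ => Iff.rfl
  have h3 : ∀ u w, (starlikeTree 1 n n).Adj (some u) (some w) ↔
      (SimpleGraph.pathGraph 1 ⊕g (SimpleGraph.pathGraph n ⊕g SimpleGraph.pathGraph n)).Adj u w :=
    fun _ _ => Iff.rfl
  rcases v with _ | k | i | i
  · simp [mulVec, dotProduct, SimpleGraph.adjMatrix_apply, h1, IsInnerEnd,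
      truncatedWeight, outerEndIndicator, hfirst, hn]
    linarith
  · simp [mulVec, dotProduct, SimpleGraph.adjMatrix_apply, h2, h3, IsInnerEnd,
      truncatedWeight, outerEndIndicator, hl, SimpleGraph.pathGraph_adj]
  · simpa [mulVec, dotProduct, SimpleGraph.adjMatrix_apply, h2, h3, IsInnerEnd,
      truncatedWeight, outerEndIndicator, SimpleGraph.pathGraph_adj] using leg_sum ht.ne' i
  · simpa [mulVec, dotProduct, SimpleGraph.adjMatrix_apply, h2, h3, IsInnerEnd,
      truncatedWeight, outerEndIndicator, SimpleGraph.pathGraph_adj] using leg_sum ht.ne' i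

theorem truncatedWeight_dotProduct_outerEndIndicator (t : ℝ) {n : ℕ} (hn : 0 < n) :
    truncatedWeight t n ⬝ᵥ outerEndIndicator n = 2 * t ^ n := by
  have h := sum_ite_val_eq (n := n) (fun j => t ^ (j + 1)) (n - 1)
  have e : ∀ j : Fin n, j.val + 1 = n ↔ j.val = n - 1 := fun j => by omega
  have e' : n - 1 + 1 = n := by omega
  simp [dotProduct, truncatedWeight, outerEndIndicator, e, h, e', hn]
  ring

/-! ### The two bounds for `T_{1,n,n}` -/

theorem graphSpectralRadius_starlikeTree_le {t : ℝ} (ht : 0 < t)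
    (hc : (t + t⁻¹)⁻¹ + 2 * t = t + t⁻¹) {n : ℕ} (hn : 0 < n) :
    graphSpectralRadius (starlikeTree 1 n n) ≤ t + t⁻¹ := by
  classical
  refine graphSpectralRadius_le_of_mulVec_le _ (truncatedWeight_pos ht n) fun v => ?_
  rw [adjMatrix_mulVec_truncatedWeight ht hc hn]
  have := mul_nonneg (pow_pos ht (n + 1)).le (outerEndIndicator_nonneg n v)
  linarith

theorem le_graphSpectralRadius_starlikeTree {t : ℝ} (ht : 0 < t)
    (hc : (t + t⁻¹)⁻¹ + 2 * t = t + t⁻¹) {n : ℕ} (hn : 0 < n) :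
    t + t⁻¹ - 2 * t ^ (2 * n + 1) ≤ graphSpectralRadius (starlikeTree 1 n n) := by
  classical
  set y := truncatedWeight t n
  have hA : (starlikeTree 1 n n).adjMatrix ℝ *ᵥ y =
      (t + t⁻¹) • y - t ^ (n + 1) • outerEndIndicator n :=
    funext fun v => adjMatrix_mulVec_truncatedWeight ht hc hn v
  have h := le_graphSpectralRadius_mul (starlikeTree 1 n n) y
  rw [hA, dotProduct_sub, dotProduct_smul, dotProduct_smul,
    truncatedWeight_dotProduct_outerEndIndicator t hn, smul_eq_mul, smul_eq_mul] at h
  -- The error term need not be divided by the squared norm: the centre alone contributes `1`.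
  have hnorm : 1 ≤ y ⬝ᵥ y := by
    have := single_le_sum (f := fun v => y v * y v) (fun v _ => mul_self_nonneg (y v))
      (mem_univ none)
    simpa [y, truncatedWeight, dotProduct] using this
  have hpow : t ^ (n + 1) * (2 * t ^ n) = 2 * t ^ (2 * n + 1) := by ring
  rw [hpow] at h
  have hp : 0 < t ^ (2 * n + 1) := pow_pos ht _
  refine le_of_mul_le_mul_right (a := y ⬝ᵥ y) ?_ (by linarith)
  nlinarith

/-! ### The limit -/

/-- The root `t` with `t ^ 2 = (√5 - 1) / 2` solves the equation at the centre. -/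
theorem exists_centre_root :
    ∃ t : ℝ, 0 < t ∧ t < 1 ∧ (t + t⁻¹)⁻¹ + 2 * t = t + t⁻¹ ∧
      t + t⁻¹ = Real.sqrt (2 + Real.sqrt 5) := by
  have h5 : Real.sqrt 5 ^ 2 = 5 := Real.sq_sqrt (by norm_num)
  have h1 : 1 < Real.sqrt 5 := by rw [Real.lt_sqrt] <;> norm_num
  have h3 : Real.sqrt 5 < 3 := by rw [Real.sqrt_lt'] <;> norm_num
  have hs : 0 < (Real.sqrt 5 - 1) / 2 := by linarith
  set t := Real.sqrt ((Real.sqrt 5 - 1) / 2)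
  have ht : 0 < t := Real.sqrt_pos.mpr hs
  have ht2 : t ^ 2 = (Real.sqrt 5 - 1) / 2 := Real.sq_sqrt hs.le
  have hquad : t ^ 4 + t ^ 2 = 1 := by
    rw [show t ^ 4 = (t ^ 2) ^ 2 by ring, ht2]
    linarith
  refine ⟨t, ht, by nlinarith, ?_, ?_⟩
  · have : t + t⁻¹ = (t ^ 2 + 1) / t := by field_simp
    rw [this, inv_div]
    field_simp
    linarith
  · symm
    rw [Real.sqrt_eq_iff_mul_self_eq (by positivity) (by positivity)]
    have hinv : t⁻¹ ^ 2 = t ^ 2 + 1 := by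
      field_simp
      linarith
    have : (t + t⁻¹) * (t + t⁻¹) = t ^ 2 + 2 * (t * t⁻¹) + t⁻¹ ^ 2 := by ring
    rw [this, hinv, mul_inv_cancel₀ ht.ne', ht2]
    ring

theorem mainTheorem2 :
    Filter.Tendsto (fun n : ℕ => graphSpectralRadius (starlikeTree 1 n n)) Filter.atTop
      (nhds (Real.sqrt (2 + Real.sqrt 5))) := by
  obtain ⟨t, ht, ht1, hc, hlim⟩ := exists_centre_root
  rw [← hlim]
  have hpow : Filter.Tendsto (fun n : ℕ => t ^ (2 * n + 1)) Filter.atTop (nhds 0) :=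
    (tendsto_pow_atTop_nhds_zero_of_lt_one ht.le ht1).comp
      (Filter.tendsto_atTop_mono (fun n => by simp only [id]; omega) Filter.tendsto_id)
  have hlow : Filter.Tendsto (fun n : ℕ => t + t⁻¹ - 2 * t ^ (2 * n + 1)) Filter.atTop
      (nhds (t + t⁻¹)) := by
    simpa using (hpow.const_mul 2).const_sub (t + t⁻¹)
  refine tendsto_of_tendsto_of_tendsto_of_le_of_le' hlow tendsto_const_nhds ?_ ?_
  · filter_upwards [Filter.eventually_gt_atTop 0] with n hn
    exact le_graphSpectralRadius_starlikeTree ht hc hn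
  · filter_upwards [Filter.eventually_gt_atTop 0] with n hn
    exact graphSpectralRadius_starlikeTree_le ht hc hn
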